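/- Let $(X,d)$ be a complete metric space, let $f_1,\dots,f_m:X\to X$ be injective contractions, and let $K\subset X$ be the non-empty compact set with $K=f_1(K)\cup\dots\cup f_m(K)$. Assume that $K$ is connected. For a word $\omega=\omega_1\cdots\omega_n\in W_n=\{1,\dots,m\}^n$ put $f_\omega=f_{\omega_1}\circ\dots\circ f_{\omega_n}$. Let $V_0$ be a set of fixed points of the maps $f_i$ (for instance the set of all of them), and assume that $K$ is finitely ramified with boundary $V_0$: for every $n$ and all distinct $\omega,\omega'\in W_n$, $$f_\omega(K)\cap f_{\omega'}(K)=f_\omega(V_0)\cap f_{\omega'}(V_0).$$ (No symmetry of $K$ is assumed.) For $n\ge 0$ let $G_n$ be the finite multigraph with vertex set $V_n=\bigcup_{\omega\in W_n}f_\omega(V_0)$ which has one edge joining $f_\omega(a)$ and $f_\omega(b)$ for every $\omega\in W_n$ and every pair $\{a,b\}$ of distinct points of $V_0$; so $G_0$ is the complete graph on $V_0$, and $G_n$ consists of $m^n$ copies of it, parallel edges being kept. Let $\tau(G_n)$ be the number of spanning trees of $G_n$. (A tree is a connected multigraph without cycles, where two parallel edges form a cycle.) 1. If $G_1$ is a tree,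 then $\tau(G_n)=1$ for all $n\ge 0$. 2. If $G_1$ is not a tree and $|V_0|>2$, then, as $n\to\infty$, $$\log\tau(G_n)=\Theta(|V_n|)=\Theta(m^n)$$ (that is, $\log\tau(G_n)$, $|V_n|$ and $m^n$ are of the same order), and $$\frac{\log 3}{2}\le\liminf_{n\to\infty}\frac{\log\tau(G_n)}{|V_n|}\le\limsup_{n\to\infty}\frac{\log\tau(G_n)}{|V_n|}\le\log\left(\frac{(m-1)\,|V_0|\,(|V_0|-1)}{|V_1|-|V_0|}\right).$$ -/

import Mathlib

open Set Filter Topology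

/-! ### Multigraphs: connectedness, trees, spanning trees -/

/-- A multigraph is connected if it has a vertex and any two of its vertices are joined by a
finite chain of adjacent vertices. -/
def Graph.IsConn {α β : Type*} (G : Graph α β) : Prop :=
  G.vertexSet.Nonempty ∧
    ∀ x ∈ G.vertexSet, ∀ y ∈ G.vertexSet, Relation.ReflTransGen G.Adj x y

/-- A multigraph contains a cycle if, for some `k ≥ 0`, there are `k + 1` distinct vertices
`v 0, …, v k` and `k + 1` distinct edges `e 0, …, e k` such that `e i` joins `v i` to `v (i + 1)`,
indices being read modulo `k + 1`. So a loop is a cycle, and so is a pair of parallel edges. -/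
def Graph.HasCycle {α β : Type*} (G : Graph α β) : Prop :=
  ∃ (k : ℕ) (v : Fin (k + 1) → α) (e : Fin (k + 1) → β),
    Function.Injective v ∧ Function.Injective e ∧ ∀ i, G.IsLink (e i) (v i) (v (i + 1))

/-- A tree is a connected multigraph without cycles. -/
def Graph.IsTree {α β : Type*} (G : Graph α β) : Prop :=
  G.IsConn ∧ ¬ G.HasCycle

/-- The number `τ(G)` of spanning trees of a multigraph: the number of sets `F` of edges such that
the subgraph with all the vertices of `G` and with edge set `F` is a tree. -/
noncomputable def Graph.numSpanningTrees {α β : Type*} (G : Graph α β) : ℕ :=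
  {F : Set β | F ⊆ G.edgeSet ∧ (G.restrict F).IsTree}.ncard

/-! ### Finitely ramified self-similar sets and their approximating graphs -/

/-- The map `f_ω = f_{ω₁} ∘ ⋯ ∘ f_{ωₙ}` of a word `ω = ω₁ ⋯ ωₙ`. -/
def wordMap {X : Type*} {m : ℕ} (f : Fin m → X → X) : List (Fin m) → X → X
  | [] => id
  | i :: w => f i ∘ wordMap f w

/-- `K` is a finitely ramified self-similar set with respect to the injective contractions
`f 0, …, f (m - 1)`, with boundary set `V₀` (a set of fixed points of these maps, possibly all
of them): two distinct cells `K_ω`, `K_ω'` of the same level meet only in the images of `V₀`. -/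
structure IsFinitelyRamified {X : Type*} [MetricSpace X] {m : ℕ} (f : Fin m → X → X)
    (K V₀ : Set X) : Prop where
  contracting : ∀ i, ∃ c : NNReal, ContractingWith c (f i)
  injective : ∀ i, Function.Injective (f i)
  nonempty : K.Nonempty
  isCompact : IsCompact K
  self_similar : K = ⋃ i, f i '' K
  boundary_fixed : ∀ x ∈ V₀, ∃ i, f i x = x
  inter_eq : ∀ w w' : List (Fin m), w.length = w'.length → w ≠ w' →
    (wordMap f w '' K) ∩ (wordMap f w' '' K) = (wordMap f w '' V₀) ∩ (wordMap f w' '' V₀)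

/-- The `n`-th approximating graph `G_n`. Its vertex set is the union `V_n` of the sets
`f_ω(V₀)` over the words `ω` of length `n`. It is made of one copy of the complete graph on `V₀`
for each word `ω` of length `n`: the edge labelled `(ω, {a, b})`, where `a ≠ b` are in `V₀`, joins
`f_ω(a)` to `f_ω(b)`. Thus `G_0` is the complete graph on `V₀`, and the edges of `G_(n+1)` are the
images under the maps `f i` of the edges of `G_n`, counted with multiplicity
(see `approxGraph_isLink_cons`). -/
def approxGraph {X : Type*} {m : ℕ} (f : Fin m → X → X) (V₀ : Set X) (n : ℕ) :
    Graph X (List (Fin m) × Sym2 X) where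
  vertexSet := ⋃ w ∈ {w : List (Fin m) | w.length = n}, wordMap f w '' V₀
  IsLink e x y := e.1.length = n ∧
    ∃ a ∈ V₀, ∃ b ∈ V₀, a ≠ b ∧ e.2 = s(a, b) ∧ wordMap f e.1 a = x ∧ wordMap f e.1 b = y
  isLink_symm e _ := ⟨by
    rintro x y ⟨hn, a, ha, b, hb, hab, he, hx, hy⟩
    exact ⟨hn, b, hb, a, ha, hab.symm, by rw [he, Sym2.eq_swap], hy, hx⟩⟩
  eq_or_eq_of_isLink_of_isLink := by
    rintro e x y v w ⟨_, a, _, b, _, _, he, rfl, rfl⟩ ⟨_, c, _, d, _, _, he', rfl, rfl⟩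
    rw [he, Sym2.eq_iff] at he'
    rcases he' with ⟨rfl, rfl⟩ | ⟨rfl, rfl⟩
    · exact Or.inl rfl
    · exact Or.inr rfl
  left_mem_of_isLink := by
    rintro e x y ⟨hn, a, ha, b, _, _, _, rfl, _⟩
    exact mem_biUnion (x := e.1) hn ⟨a, ha, rfl⟩

/-- The recursive description of the edges: `(i :: w, s)` joins `x` and `y` in `G_(n+1)` exactly
when `(w, s)` joins in `G_n` points `a`, `b` with `f i a = x` and `f i b = y`. -/
theorem approxGraph_isLink_cons {X : Type*} {m : ℕ} (f : Fin m → X → X) (V₀ : Set X) (n : ℕ)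
    (i : Fin m) (w : List (Fin m)) (s : Sym2 X) (x y : X) :
    (approxGraph f V₀ (n + 1)).IsLink (i :: w, s) x y ↔
      ∃ a b, (approxGraph f V₀ n).IsLink (w, s) a b ∧ f i a = x ∧ f i b = y := by
  constructor
  · rintro ⟨hn, a, ha, b, hb, hab, he, hx, hy⟩
    exact ⟨_, _, ⟨by simpa using hn, a, ha, b, hb, hab, he, rfl, rfl⟩, hx, hy⟩
  · rintro ⟨_, _, ⟨hn, a, ha, b, hb, hab, he, rfl, rfl⟩, hx, hy⟩
    exact ⟨by simpa using hn, a, ha, b, hb, hab, he, hx, hy⟩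

/-!
The graph `G n` is connected: otherwise the `n`-cells whose vertices lie in one component and the
remaining `n`-cells would split the connected set `K` into two disjoint closed parts. For connected
finite multigraphs, spanning trees are the trees grown from a fixed root one pendant edge at a time
(`Graph.TreeOn`, `Graph.isTree_restrict_iff`), and everything is read off from such growth.

* A connected graph is a tree exactly when `|E| + 1 = |V|`, and then it is its only spanning tree.
  The numbers of edges and vertices are explicit: `|E n| = m ^ n * (|V₀| choose 2)`, and
  `|V (n + 1)| - |V 1| = m * (|V n| - |V 0|)`, because outside `V 1` the set `V (n + 1)` consists of
  `m` disjoint copies of `V n \ V 0`. Hence if `G 1` is a tree, so is every `G n`.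
* If `|V₀| > 2`, every edge lies in a triangle, and this alone gives `3 ^ |V| ≤ 3 * τ ^ 2`
  (`Graph.three_pow_le_numSpanningTrees`): a growing tree can be extended along a triangle by one
  vertex in two ways, or by two vertices in three ways, so that each new vertex contributes a
  factor of at least `√3`.
* Every vertex other than the root chooses the edge by which it was attached, so `τ` is at most the
  product of the degrees of these vertices. As the degrees add up to `2 |E|`, concavity of the
  logarithm (`Graph.log_numSpanningTrees_le`) bounds `log τ` by `|V| log c + O(1)`, where
  `c = (m - 1) |V₀| (|V₀| - 1) / (|V 1| - |V₀|)` is the limit of the average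
  degrees `2 |E n| / |V n|`.
  Here `|V 1| > |V₀|`, since a contraction cannot map the finite set `V₀` injectively to itself.
-/

open scoped Graph

/-! ### Trees grown from a root and simple paths -/

/-- `G.TreeOn r U F`: the set `F` of edges of `G` is the edge set of a tree with vertex set `U`
grown inside `G` from the root `r`, one pendant edge at a time. -/
inductive Graph.TreeOn {α β : Type*} (G : Graph α β) (r : α) : Set α → Set β → Prop
  | root : r ∈ V(G) → G.TreeOn r {r} ∅
  | grow {U : Set α} {F : Set β} {u v : α} {e : β} : G.TreeOn r U F → u ∈ U → v ∉ U →
      G.IsLink e u v → G.TreeOn r (insert v U) (insert e F)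

/-- `G.SimplePath F x y`: there is a path from `x` to `y` in `G` with distinct vertices
`v 0, …, v k` and distinct edges `e 0, …, e (k - 1)`, all taken from `F`. Values of `v` and `e`
beyond these indices are irrelevant. -/
def Graph.SimplePath {α β : Type*} (G : Graph α β) (F : Set β) (x y : α) : Prop :=
  ∃ (k : ℕ) (v : ℕ → α) (e : ℕ → β), v 0 = x ∧ v k = y ∧ InjOn v {i | i ≤ k} ∧
    InjOn e {i | i < k} ∧ ∀ i < k, e i ∈ F ∧ G.IsLink (e i) (v i) (v (i + 1))

namespace Graph

variable {α β : Type*} {G H : Graph α β} {r u v x y : α} {e : β} {U : Set α} {F F' : Set β}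

/-! ### Properties of trees grown from a root -/

lemma TreeOn.root_mem (h : G.TreeOn r U F) : r ∈ U := by
  induction h with
  | root h => exact rfl
  | grow _ _ _ _ ih => exact Or.inr ih

lemma TreeOn.subset_vertexSet (h : G.TreeOn r U F) : U ⊆ V(G) := by
  induction h with
  | root h => simpa using h
  | grow _ _ _ he ih => exact insert_subset he.right_mem ih

lemma TreeOn.subset_edgeSet (h : G.TreeOn r U F) : F ⊆ E(G) := by
  induction h with
  | root h => simp
  | grow _ _ _ he ih => exact insert_subset he.edge_mem ih

lemma TreeOn.left_mem (h : G.TreeOn r U F) (he : e ∈ F) (hl : G.IsLink e x y) : x ∈ U := by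
  induction h with
  | root h => simp at he
  | grow _ hu _ hl' ih =>
    rcases he with rfl | he
    · rcases hl.left_eq_or_eq hl' with rfl | rfl
      · exact Or.inr hu
      · exact Or.inl rfl
    · exact Or.inr (ih he)

lemma TreeOn.right_mem (h : G.TreeOn r U F) (he : e ∈ F) (hl : G.IsLink e x y) : y ∈ U :=
  h.left_mem he hl.symm

lemma TreeOn.notMem (h : G.TreeOn r U F) (hv : v ∉ U) (hl : G.IsLink e u v) : e ∉ F :=
  fun he ↦ hv (h.right_mem he hl)

lemma TreeOn.mono (hle : H ≤ G) (h : H.TreeOn r U F) : G.TreeOn r U F := by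
  induction h with
  | root h => exact .root (hle.vertexSet_mono h)
  | grow _ hu hv he ih => exact .grow ih hu hv (hle.isLink_mono he)

/-- A tree on `U` has one edge fewer than vertices. -/
lemma TreeOn.ncard (h : G.TreeOn r U F) : U.Finite ∧ F.Finite ∧ F.ncard + 1 = U.ncard := by
  induction h with
  | root h => simp
  | grow ht hu hv he ih =>
    obtain ⟨hU, hF, hc⟩ := ih
    refine ⟨hU.insert _, hF.insert _, ?_⟩
    rw [ncard_insert_of_notMem (ht.notMem hv he) hF, ncard_insert_of_notMem hv hU, hc]

lemma TreeOn.reachable (h : G.TreeOn r U F) (hF : F ⊆ F') (hx : x ∈ U) :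
    Relation.ReflTransGen (G.restrict F').Adj r x := by
  induction h generalizing x with
  | root h => rw [mem_singleton_iff.1 hx]
  | @grow U F u v e _ hu hv he ih =>
    have hF0 : F ⊆ F' := (subset_insert _ _).trans hF
    rcases hx with rfl | hx
    · exact (ih hF0 hu).tail ⟨e, hF (mem_insert _ _), he⟩
    · exact ih hF0 hx

lemma reachable_symm (h : Relation.ReflTransGen G.Adj x y) : Relation.ReflTransGen G.Adj y x :=
  have : Std.Symm G.Adj := ⟨fun _ _ h ↦ (G.adj_comm _ _).1 h⟩
  Relation.ReflTransGen.stdSymm.symm _ _ h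

lemma TreeOn.isConn (h : G.TreeOn r V(G) F) : (G.restrict F).IsConn :=
  ⟨⟨r, h.root_mem⟩, fun _ hx _ hy ↦
    (reachable_symm (h.reachable subset_rfl hx)).trans (h.reachable subset_rfl hy)⟩

/-- A cycle in `F ∪ {e}` cannot use the pendant edge `e`, as its pendant end `v` would have to be
left again along an edge of `F`. -/
lemma TreeOn.not_hasCycle (h : G.TreeOn r U F) : ¬ (G.restrict F).HasCycle := by
  induction h with
  | root h => rintro ⟨k, v, e, -, -, h⟩; exact (h 0).1
  | @grow U F u w f ht hu hw hf ih =>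
    rintro ⟨k, v, e, hv, he, hl⟩
    by_cases hfe : ∃ i, e i = f
    · have hwv : ∃ i, v (i + 1) = w := by
        obtain ⟨i, hi⟩ := hfe
        have h1 := (hl i).2
        rw [hi] at h1
        rcases hf.right_eq_or_eq h1 with h2 | h2
        · exact ⟨i - 1, by rw [sub_add_cancel, h2]⟩
        · exact ⟨i, h2.symm⟩
      obtain ⟨i, rfl⟩ := hwv
      have key : ∀ {g x}, g ∈ insert f F → G.IsLink g x (v (i + 1)) → g = f := by
        rintro g x (hg | hg) hgl
        · exact hg
        · exact absurd hg (ht.notMem hw hgl)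
      -- Both edges of the cycle at the pendant vertex are equal to `f`, so the cycle is a loop.
      have h1 := key (hl i).1 (hl i).2
      have h2 := key (hl (i + 1)).1 (hl (i + 1)).2.symm
      have h3 := he (h1.trans h2.symm)
      have h4 := (hl i).2
      rw [h1, ← h3] at h4
      rcases hf.left_eq_or_eq h4 with h6 | h6 <;> exact hw (h3 ▸ h6 ▸ hu)
    · exact ih ⟨k, v, e, hv, he, fun i ↦
        ⟨(hl i).1.resolve_left fun h ↦ hfe ⟨i, h⟩, (hl i).2⟩⟩

lemma TreeOn.isTree (h : G.TreeOn r V(G) F) : (G.restrict F).IsTree :=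
  ⟨h.isConn, h.not_hasCycle⟩

/-! ### Spanning trees as trees grown from a root -/

lemma SimplePath.refl (x : α) [Nonempty β] : G.SimplePath F x x :=
  ⟨0, fun _ ↦ x, fun _ ↦ Classical.arbitrary β, rfl, rfl,
    fun i hi j hj _ ↦ by simp only [mem_ofPred_eq] at hi hj; omega, by simp [InjOn], by simp⟩

lemma SimplePath.symm (h : G.SimplePath F x y) : G.SimplePath F y x := by
  obtain ⟨k, v, e, h0, hk, hv, he, hl⟩ := h
  refine ⟨k, fun i ↦ v (k - i), fun i ↦ e (k - 1 - i), by simpa, by simpa, ?_, ?_, ?_⟩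
  · intro i hi j hj hij
    simp only [mem_ofPred_eq] at hi hj
    have := hv (x₁ := k - i) (by simp) (x₂ := k - j) (by simp) hij
    omega
  · intro i hi j hj hij
    simp only [mem_ofPred_eq] at hi hj
    have := he (x₁ := k - 1 - i) (by simp only [mem_ofPred_eq]; omega)
      (x₂ := k - 1 - j) (by simp only [mem_ofPred_eq]; omega) hij
    omega
  · intro i hi
    obtain ⟨h1, h2⟩ := hl (k - 1 - i) (by omega)
    refine ⟨h1, ?_⟩
    rw [show k - 1 - i + 1 = k - i by omega] at h2
    dsimp only
    rw [show k - (i + 1) = k - 1 - i by omega]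
    exact h2.symm

lemma SimplePath.mono (hF : F ⊆ F') (h : G.SimplePath F x y) : G.SimplePath F' x y := by
  obtain ⟨k, v, e, h0, hk, hv, he, hl⟩ := h
  exact ⟨k, v, e, h0, hk, hv, he, fun i hi ↦ ⟨hF (hl i hi).1, (hl i hi).2⟩⟩

/-- Extension of a path by a pendant edge. -/
lemma SimplePath.cons (h : G.SimplePath F u y) (hyv : y ≠ v)
    (hv : ∀ e ∈ F, ¬ G.Inc e v) (hl : G.IsLink e v u) : G.SimplePath (insert e F) v y := by
  obtain ⟨k, w, f, rfl, hk, hw, hf, hl'⟩ := h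
  have hwv : ∀ i ≤ k, w i ≠ v := by
    intro i hi hiv
    rcases hi.lt_or_eq with hi | rfl
    · exact hv _ (hl' i hi).1 (hiv ▸ (hl' i hi).2.inc_left)
    · exact hyv (hk ▸ hiv)
  have hfe : ∀ i < k, f i ≠ e := by
    rintro i hi rfl
    exact hv _ (hl' i hi).1 hl.inc_left
  refine ⟨k + 1, fun i ↦ Nat.casesOn i v w, fun i ↦ Nat.casesOn i e f, rfl, hk, ?_, ?_, ?_⟩
  · rintro (_ | i) hi (_ | j) hj hij
    · rfl
    · exact absurd hij.symm (hwv j (by simpa using hj))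
    · exact absurd hij (hwv i (by simpa using hi))
    · rw [hw (by simpa using hi) (by simpa using hj) hij]
  · rintro (_ | i) hi (_ | j) hj hij
    · rfl
    · exact absurd hij.symm (hfe j (by simpa using hj))
    · exact absurd hij (hfe i (by simpa using hi))
    · rw [hf (by simpa using hi) (by simpa using hj) hij]
  · rintro (_ | i) hi
    · exact ⟨mem_insert _ _, hl⟩
    · exact ⟨Or.inr (hl' i (by omega)).1, (hl' i (by omega)).2⟩

lemma TreeOn.simplePath [Nonempty β] (h : G.TreeOn r U F) (hx : x ∈ U) (hy : y ∈ U) :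
    G.SimplePath F x y := by
  induction h generalizing x y with
  | root h => rw [mem_singleton_iff.1 hx, mem_singleton_iff.1 hy]; exact .refl _
  | @grow U F u w f ht hu hw hf ih =>
    have hinc : ∀ e ∈ F, ¬ G.Inc e w := fun e he ⟨z, hz⟩ ↦ hw (ht.left_mem he hz)
    have key : ∀ z ∈ U, G.SimplePath (insert f F) w z := fun z hz ↦
      (ih hu hz).cons (fun h ↦ hw (h ▸ hz)) hinc hf.symm
    rcases hx with rfl | hx <;> rcases hy with rfl | hy
    · exact .refl _
    · exact key _ hy
    · exact (key _ hx).symm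
    · exact (ih hx hy).mono (subset_insert _ _)

/-- A further edge between vertices of a tree closes a cycle with the tree path joining its
ends. -/
lemma SimplePath.hasCycle (h : G.SimplePath F x y) (he : e ∉ F) (hl : G.IsLink e x y) :
    G.HasCycle := by
  obtain ⟨k, v, f, h0, hk, hv, hf, hl'⟩ := h
  refine ⟨k, fun i ↦ v i, fun i ↦ if (i : ℕ) < k then f i else e, ?_, ?_, ?_⟩
  · intro i j hij
    exact Fin.ext (hv (by simp; omega) (by simp; omega) hij)
  · intro i j hij
    dsimp only at hij
    split_ifs at hij with h1 h2 h2
    · exact Fin.ext (hf h1 h2 hij)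
    · exact absurd (hij ▸ (hl' i h1).1) he
    · exact absurd (hij ▸ (hl' j h2).1) he
    · exact Fin.ext (by omega)
  · intro i
    by_cases hi : (i : ℕ) < k
    · have h1 : ((i + 1 : Fin (k + 1)) : ℕ) = i + 1 := by
        rw [Fin.val_add_one_of_lt]
        exact Fin.lt_def.2 (by simpa using hi)
      simpa only [hi, if_true, h1] using (hl' i hi).2
    · have h1 : i = Fin.last k := Fin.ext (by simp; omega)
      subst h1
      simp only [Fin.val_last, lt_irrefl, if_false, Fin.last_add_one, Fin.val_zero, h0, hk]
      exact hl.symm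

/-- In a connected graph some edge leaves any non-empty proper set of vertices. -/
lemma IsConn.exists_isLink (h : G.IsConn) (hU : U ⊆ V(G)) (hr : r ∈ U) (hne : U ≠ V(G)) :
    ∃ u ∈ U, ∃ v ∉ U, ∃ e, G.IsLink e u v := by
  obtain ⟨y, hy, hyU⟩ := exists_of_ssubset (hU.ssubset_of_ne hne)
  have h1 := h.2 r (hU hr) y hy
  by_contra! hcon
  apply hyU
  clear hy hyU
  induction h1 with
  | refl => exact hr
  | @tail b c _ hbc ih =>
    obtain ⟨e, he⟩ := hbc
    by_contra hc
    exact hcon b ih c hc e he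

lemma IsConn.exists_treeOn (h : G.IsConn) (hV : V(G).Finite) (hr : r ∈ V(G)) :
    ∃ F, G.TreeOn r V(G) F := by
  suffices H : ∀ n, ∀ U F, G.TreeOn r U F → (V(G) \ U).ncard = n → ∃ F, G.TreeOn r V(G) F from
    H _ _ _ (.root hr) rfl
  intro n
  induction n with
  | zero =>
    intro U F ht hn
    rw [ncard_eq_zero hV.sdiff, sdiff_eq_empty] at hn
    exact ⟨F, subset_antisymm hn ht.subset_vertexSet ▸ ht⟩
  | succ n ih =>
    intro U F ht hn
    have hne : U ≠ V(G) := by rintro rfl; simp at hn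
    obtain ⟨u, hu, v, hv, e, he⟩ := h.exists_isLink ht.subset_vertexSet ht.root_mem hne
    refine ih _ _ (.grow ht hu hv he) ?_
    rw [← union_singleton, ← sdiff_sdiff,
      ncard_sdiff_singleton_of_mem (mem_sdiff _ |>.2 ⟨he.right_mem, hv⟩), hn]
    rfl

lemma IsTree.treeOn (h : G.IsTree) (hV : V(G).Finite) (hr : r ∈ V(G)) :
    G.TreeOn r V(G) E(G) := by
  obtain ⟨F, hF⟩ := h.1.exists_treeOn hV hr
  suffices E(G) ⊆ F from subset_antisymm this hF.subset_edgeSet ▸ hF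
  intro e he
  obtain ⟨x, y, hl⟩ := G.exists_isLink_of_mem_edgeSet he
  by_contra heF
  have : Nonempty β := ⟨e⟩
  exact h.2 ((hF.simplePath hl.left_mem hl.right_mem).hasCycle heF hl)

/-- The spanning trees of a finite graph are the trees grown from a fixed root to the whole vertex
set. -/
lemma isTree_restrict_iff (hV : V(G).Finite) (hr : r ∈ V(G)) :
    (F ⊆ E(G) ∧ (G.restrict F).IsTree) ↔ G.TreeOn r V(G) F := by
  refine ⟨fun ⟨hF, h⟩ ↦ ?_, fun h ↦ ⟨h.subset_edgeSet, h.isTree⟩⟩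
  have h1 := (h.treeOn hV hr).mono restrict_le
  rwa [edgeSet_restrict, inter_eq_self_of_subset_right hF] at h1

lemma numSpanningTrees_eq (hV : V(G).Finite) (hr : r ∈ V(G)) :
    G.numSpanningTrees = {F | G.TreeOn r V(G) F}.ncard := by
  simp only [numSpanningTrees, isTree_restrict_iff hV hr]

lemma isTree_iff (h : G.IsConn) (hV : V(G).Finite) (hE : E(G).Finite) :
    G.IsTree ↔ E(G).ncard + 1 = V(G).ncard := by
  obtain ⟨r, hr⟩ := h.1
  refine ⟨fun h ↦ (h.treeOn hV hr).ncard.2.2, fun hc ↦ ?_⟩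
  obtain ⟨F, hF⟩ := h.exists_treeOn hV hr
  have h1 := hF.ncard.2.2
  have h2 : F = E(G) := eq_of_subset_of_ncard_le hF.subset_edgeSet (by omega) hE
  simpa [h2] using hF.isTree

lemma IsTree.numSpanningTrees_eq_one (h : G.IsTree) (hV : V(G).Finite) (hE : E(G).Finite) :
    G.numSpanningTrees = 1 := by
  obtain ⟨r, hr⟩ := h.1.1
  rw [numSpanningTrees_eq hV hr, ncard_eq_one]
  have h0 := h.treeOn hV hr
  refine ⟨E(G), eq_singleton_iff_unique_mem.2 ⟨h0, fun F hF ↦ ?_⟩⟩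
  have h1 := hF.ncard.2.2
  have h2 := h0.ncard.2.2
  exact eq_of_subset_of_ncard_le hF.subset_edgeSet (by omega) hE

lemma finite_setOf_treeOn (hE : E(G).Finite) : {F | G.TreeOn r U F}.Finite :=
  hE.finite_subsets.subset fun _ hF ↦ hF.subset_edgeSet

/-! ### A lower bound for the number of spanning trees -/

/-- The sets `A ∪ F`, with `A` in `P` and `F` in `S`, are pairwise different if a set `D` contains
the former and is disjoint from the latter. -/
lemma ncard_mul_ncard_le {P S T : Set (Set β)} (D : Set β) (hT : T.Finite) (hP : ∀ A ∈ P, A ⊆ D)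
    (hS : ∀ F ∈ S, Disjoint F D) (h : ∀ A ∈ P, ∀ F ∈ S, A ∪ F ∈ T) :
    P.ncard * S.ncard ≤ T.ncard := by
  rw [← ncard_prod]
  refine ncard_le_ncard_of_injOn (fun p ↦ p.1 ∪ p.2) (fun p hp ↦ h _ hp.1 _ hp.2) ?_ hT
  rintro ⟨A, F⟩ ⟨hA, hF⟩ ⟨A', F'⟩ ⟨hA', hF'⟩ heq
  dsimp only at hA hF hA' hF' heq
  have key : ∀ {A F}, A ∈ P → F ∈ S → (A ∪ F) ∩ D = A ∧ (A ∪ F) \ D = F := by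
    intro A F hA hF
    rw [union_inter_distrib_right, union_sdiff_distrib, inter_eq_self_of_subset_left (hP A hA),
      (hS F hF).inter_eq, sdiff_eq_empty.2 (hP A hA), (hS F hF).sdiff_eq_left]
    simp
  have h1 := key hA hF
  have h2 := key hA' hF'
  rw [heq] at h1
  rw [← h1.1, ← h1.2, h2.1, h2.2]

lemma two_mul_ncard_treeOn_le (hE : E(G).Finite) {e₁ e₂ : β} {u₁ u₂ : α} (hu₁ : u₁ ∈ U)
    (hu₂ : u₂ ∈ U) (hv : v ∉ U) (h₁ : G.IsLink e₁ u₁ v) (h₂ : G.IsLink e₂ u₂ v) (hne : e₁ ≠ e₂) :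
    2 * {F | G.TreeOn r U F}.ncard ≤ {F | G.TreeOn r (insert v U) F}.ncard := by
  have hP : ({{e₁}, {e₂}} : Set (Set β)).ncard = 2 := ncard_pair (by simpa using hne)
  rw [← hP]
  refine ncard_mul_ncard_le {e₁, e₂} (finite_setOf_treeOn hE) ?_ ?_ ?_
  · rintro A (rfl | rfl) <;> simp
  · intro F hF
    simp only [disjoint_insert_right, disjoint_singleton_right]
    exact ⟨hF.notMem hv h₁, hF.notMem hv h₂⟩
  · rintro A (rfl | rfl) F hF
    · exact .grow hF hu₁ hv h₁
    · exact .grow hF hu₂ hv h₂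

lemma three_mul_ncard_treeOn_le (hE : E(G).Finite) {e₁ e₂ e₃ : β} (hu : u ∈ U)
    (hx : x ∉ U) (hy : y ∉ U) (hxy : x ≠ y) (h₁ : G.IsLink e₁ u x) (h₂ : G.IsLink e₂ u y)
    (h₃ : G.IsLink e₃ x y) :
    3 * {F | G.TreeOn r U F}.ncard ≤ {F | G.TreeOn r (insert y (insert x U)) F}.ncard := by
  have hux : u ≠ x := fun h ↦ hx (h ▸ hu)
  have huy : u ≠ y := fun h ↦ hy (h ▸ hu)
  have h12 : e₁ ≠ e₂ := by rintro rfl; exact hxy (h₁.right_unique h₂)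
  have h13 : e₁ ≠ e₃ := by rintro rfl; exact huy (h₁.symm.right_unique h₃)
  have h23 : e₂ ≠ e₃ := by rintro rfl; exact hux (h₂.symm.right_unique h₃.symm)
  have hP : ({{e₁, e₂}, {e₁, e₃}, {e₂, e₃}} : Set (Set β)).ncard = 3 := by
    rw [ncard_eq_three]
    refine ⟨_, _, _, fun h ↦ ?_, fun h ↦ ?_, fun h ↦ ?_, rfl⟩
    · have : e₂ ∈ ({e₁, e₃} : Set β) := h ▸ by simp
      simp [h12.symm, h23] at this
    · have : e₁ ∈ ({e₂, e₃} : Set β) := h ▸ by simp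
      simp [h12, h13] at this
    · have : e₁ ∈ ({e₂, e₃} : Set β) := h ▸ by simp
      simp [h12, h13] at this
  rw [← hP]
  refine ncard_mul_ncard_le {e₁, e₂, e₃} (finite_setOf_treeOn hE) ?_ ?_ ?_
  · rintro A (rfl | rfl | rfl) <;> grind
  · intro F hF
    simp only [disjoint_insert_right, disjoint_singleton_right]
    exact ⟨hF.notMem hx h₁, hF.notMem hy h₂, hF.notMem hy h₃⟩
  · have hyx : y ∉ insert x U := by simp [hxy.symm, hy]
    have hxy' : x ∉ insert y U := by simp [hxy, hx]
    rintro A (rfl | rfl | rfl) F hF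
    · have := (TreeOn.grow hF hu hx h₁).grow (Or.inr hu) hyx h₂
      rw [insert_comm e₂ e₁] at this
      simpa [insert_union] using this
    · have := (TreeOn.grow hF hu hx h₁).grow (Or.inl rfl) hyx h₃
      rw [insert_comm e₃ e₁] at this
      simpa [insert_union] using this
    · have := (TreeOn.grow hF hu hy h₂).grow (Or.inl rfl) hxy' h₃.symm
      rw [insert_comm e₃ e₂, insert_comm x y] at this
      simpa [insert_union] using this

/-- If every edge of a connected graph lies in a triangle, then `3 ^ |V| ≤ 3 τ²`. A tree on a
proper set `U` of vertices can be extended along a triangle leaving `U`: if the triangle has one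
further vertex, there are two ways to attach it, and if it has two, there are three ways to
attach both. -/
lemma three_pow_le_numSpanningTrees (h : G.IsConn) (hV : V(G).Finite) (hE : E(G).Finite)
    (htri : ∀ u v, u ≠ v → G.Adj u v → ∃ w, w ≠ u ∧ w ≠ v ∧ G.Adj u w ∧ G.Adj v w) :
    3 ^ V(G).ncard ≤ 3 * G.numSpanningTrees ^ 2 := by
  obtain ⟨r, hr⟩ := h.1
  rw [numSpanningTrees_eq hV hr]
  suffices H : ∀ n, ∀ U, (V(G) \ U).ncard = n → U ⊆ V(G) → r ∈ U →
      3 ^ U.ncard ≤ 3 * {F | G.TreeOn r U F}.ncard ^ 2 →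
      3 ^ V(G).ncard ≤ 3 * {F | G.TreeOn r V(G) F}.ncard ^ 2 by
    refine H _ {r} rfl (by simpa using hr) rfl ?_
    have : 0 < {F | G.TreeOn r {r} F}.ncard :=
      (ncard_pos (finite_setOf_treeOn hE)).2 ⟨∅, .root hr⟩
    rw [ncard_singleton]
    nlinarith
  intro n
  induction n using Nat.strong_induction_on with
  | _ n ih =>
  intro U hn hU hrU hle
  by_cases hUV : U = V(G)
  · rwa [hUV] at hle
  obtain ⟨u, hu, v, hv, e, he⟩ := h.exists_isLink hU hrU hUV
  have hUfin := hV.subset hU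
  obtain ⟨w, hwu, hwv, ⟨e', he'⟩, ⟨e'', he''⟩⟩ := htri u v (fun h ↦ hv (h ▸ hu)) ⟨e, he⟩
  -- `v ∉ U` is joined to `U` twice if `w ∈ U`; otherwise `v` and `w` are attached together.
  by_cases hw : w ∈ U
  · refine ih _ ?_ (insert v U) rfl (insert_subset he.right_mem hU) (Or.inr hrU) ?_
    · rw [← hn]
      exact ncard_lt_ncard ⟨sdiff_subset_sdiff_right (subset_insert _ _), fun hs ↦
        (hs ⟨he.right_mem, hv⟩).2 (mem_insert _ _)⟩ hV.sdiff
    · have hee : e ≠ e'' := by rintro rfl; exact hwu (he.symm.right_unique he'').symm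
      have := two_mul_ncard_treeOn_le (r := r) hE hu hw hv he he''.symm hee
      rw [ncard_insert_of_notMem hv hUfin, pow_succ]
      nlinarith
  · refine ih _ ?_ (insert w (insert v U)) rfl
      (insert_subset he'.right_mem (insert_subset he.right_mem hU)) (Or.inr (Or.inr hrU)) ?_
    · rw [← hn]
      exact ncard_lt_ncard ⟨sdiff_subset_sdiff_right
        ((subset_insert _ _).trans (subset_insert _ _)), fun hs ↦
        (hs ⟨he.right_mem, hv⟩).2 (Or.inr (mem_insert _ _))⟩ hV.sdiff
    · have := three_mul_ncard_treeOn_le (r := r) hE hu hv hw hwv.symm he he' he''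
      rw [ncard_insert_of_notMem (by simp [hwv, hw]) (hUfin.insert _),
        ncard_insert_of_notMem hv hUfin, pow_succ, pow_succ]
      nlinarith

/-! ### An upper bound for the number of spanning trees -/

/-- Every vertex of a tree other than the root chooses the edge by which it was attached. -/
lemma TreeOn.exists_choice [Nonempty β] (h : G.TreeOn r U F) :
    ∃ p : α → β, (∀ v ∈ U, v ≠ r → G.Inc (p v) v) ∧ F = p '' (U \ {r}) := by
  classical
  induction h with
  | root h => exact ⟨fun _ ↦ Classical.arbitrary β, by simp, by simp⟩
  | @grow U F u w f ht hu hw hf ih =>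
    obtain ⟨p, hp, rfl⟩ := ih
    have hwr : w ≠ r := fun h ↦ hw (h ▸ ht.root_mem)
    refine ⟨Function.update p w f, ?_, ?_⟩
    · rintro v (rfl | hv) hvr
      · simpa using hf.inc_right
      · rw [Function.update_of_ne (ne_of_mem_of_not_mem hv hw)]
        exact hp v hv hvr
    · rw [insert_sdiff_of_notMem _ (by simpa using hwr), image_insert_eq, Function.update_self]
      congr 1
      refine image_congr fun v hv ↦ ?_
      rw [Function.update_of_ne (ne_of_mem_of_not_mem hv.1 hw)]

lemma numSpanningTrees_le_prod [Nonempty β] [DecidableEq α] (hV : V(G).Finite)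
    (hE : E(G).Finite) (hr : r ∈ V(G)) :
    G.numSpanningTrees ≤ ∏ v ∈ hV.toFinset.erase r, (G.incidenceSet v).ncard := by
  have hI : ∀ v, (G.incidenceSet v).Finite := fun v ↦ hE.subset (G.incidenceSet_subset_edgeSet v)
  rw [numSpanningTrees_eq hV hr]
  calc {F | G.TreeOn r V(G) F}.ncard
      ≤ (SetLike.coe ((hV.toFinset.erase r).pi fun v ↦ (hI v).toFinset)).ncard := by
        let g (q : ∀ v ∈ hV.toFinset.erase r, β) : Set β :=
          {e | ∃ v, ∃ hv : v ∈ hV.toFinset.erase r, q v hv = e}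
        refine (ncard_le_ncard (t := g '' _) ?_ ((Finset.finite_toSet _).image g)).trans
          (ncard_image_le (Finset.finite_toSet _))
        intro F hF
        obtain ⟨p, hp, rfl⟩ := TreeOn.exists_choice hF
        refine ⟨fun v _ ↦ p v, ?_, ?_⟩
        · simp only [SetLike.mem_coe, Finset.mem_pi, Finset.mem_erase, Finite.mem_toFinset,
            mem_incidenceSet]
          exact fun v hv ↦ hp v hv.2 hv.1
        · ext e
          simp [g, and_comm]
    _ = _ := by
        rw [ncard_coe_finset, Finset.card_pi]
        exact Finset.prod_congr rfl fun v _ ↦ (ncard_eq_toFinset_card _ (hI v)).symm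

lemma sum_ncard_incidenceSet_le (hV : V(G).Finite) (hE : E(G).Finite) :
    ∑ v ∈ hV.toFinset, (G.incidenceSet v).ncard ≤ 2 * E(G).ncard := by
  classical
  have h1 := Finset.sum_card_bipartiteAbove_eq_sum_card_bipartiteBelow
    (fun v e ↦ G.Inc e v) (s := hV.toFinset) (t := hE.toFinset)
  calc ∑ v ∈ hV.toFinset, (G.incidenceSet v).ncard
      = ∑ v ∈ hV.toFinset, (hE.toFinset.bipartiteAbove (fun v e ↦ G.Inc e v) v).card := by
        refine Finset.sum_congr rfl fun v _ ↦ ?_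
        rw [← ncard_coe_finset]
        congr 1
        ext e
        simpa [Finset.bipartiteAbove] using fun h : G.Inc e v ↦ h.edge_mem
    _ = ∑ e ∈ hE.toFinset, (hV.toFinset.bipartiteBelow (fun v e ↦ G.Inc e v) e).card := h1
    _ ≤ ∑ e ∈ hE.toFinset, 2 := by
        refine Finset.sum_le_sum fun e he ↦ ?_
        obtain ⟨x, y, hl⟩ := G.exists_isLink_of_mem_edgeSet (hE.mem_toFinset.1 he)
        refine (Finset.card_le_card (t := {x, y}) fun v hv ↦ ?_).trans Finset.card_le_two
        simpa using ((Finset.mem_filter.1 hv).2).eq_or_eq_of_isLink hl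
    _ = 2 * E(G).ncard := by
        rw [Finset.sum_const, smul_eq_mul, mul_comm, ncard_eq_toFinset_card _ hE]

/-- The bound of `τ` by a product of degrees, combined with the tangent line bound
`log d ≤ d / c - 1 + log c` for each degree `d`. It is sharpest when `c` is the average degree. -/
lemma log_numSpanningTrees_le [Nonempty β] (hV : V(G).Finite) (hE : E(G).Finite) (hr : r ∈ V(G))
    (hpos : 0 < G.numSpanningTrees) {c : ℝ} (hc : 0 < c) :
    Real.log G.numSpanningTrees ≤
      2 * E(G).ncard / c - (V(G).ncard - 1) + (V(G).ncard - 1) * Real.log c := by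
  classical
  set s := hV.toFinset.erase r with hs
  have hcard : (s.card : ℝ) = V(G).ncard - 1 := by
    have h1 : r ∈ hV.toFinset := by simpa using hr
    rw [eq_sub_iff_add_eq, ncard_eq_toFinset_card _ hV]
    exact_mod_cast Finset.card_erase_add_one h1
  have hle := numSpanningTrees_le_prod hV hE hr
  rw [← hs] at hle
  have hdpos : ∀ v ∈ s, 0 < (G.incidenceSet v).ncard := fun v hv ↦
    Nat.pos_of_ne_zero fun h0 ↦ by
      rw [Finset.prod_eq_zero hv h0] at hle
      omega
  have hsum : ∑ v ∈ s, ((G.incidenceSet v).ncard : ℝ) ≤ 2 * E(G).ncard := by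
    refine (Finset.sum_le_sum_of_subset_of_nonneg (Finset.erase_subset _ _) ?_).trans ?_
    · intros; positivity
    · exact_mod_cast sum_ncard_incidenceSet_le hV hE
  calc Real.log G.numSpanningTrees
      ≤ Real.log (∏ v ∈ s, ((G.incidenceSet v).ncard : ℝ)) :=
        Real.log_le_log (by exact_mod_cast hpos) (by exact_mod_cast hle)
    _ = ∑ v ∈ s, Real.log ((G.incidenceSet v).ncard : ℝ) :=
        Real.log_prod fun v hv ↦ by exact_mod_cast (hdpos v hv).ne'
    _ ≤ ∑ v ∈ s, (((G.incidenceSet v).ncard : ℝ) / c - 1 + Real.log c) := by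
        refine Finset.sum_le_sum fun v hv ↦ ?_
        have hd : (0 : ℝ) < (G.incidenceSet v).ncard := by exact_mod_cast hdpos v hv
        have := Real.log_le_sub_one_of_pos (div_pos hd hc)
        rw [Real.log_div hd.ne' hc.ne'] at this
        linarith
    _ = (∑ v ∈ s, ((G.incidenceSet v).ncard : ℝ)) / c - s.card + s.card * Real.log c := by
        rw [Finset.sum_add_distrib, Finset.sum_sub_distrib, Finset.sum_div]
        simp
    _ ≤ _ := by
        rw [hcard]
        gcongr

end Graph

/-! ### Vertices and edges of the approximating graphs -/

section approxGraph

variable {X : Type*} {m : ℕ} {f : Fin m → X → X} {V₀ : Set X}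

lemma finite_words (m n : ℕ) : {w : List (Fin m) | w.length = n}.Finite :=
  List.finite_length_eq _ _

lemma ncard_words (m n : ℕ) : {w : List (Fin m) | w.length = n}.ncard = m ^ n := by
  have := card_vector (α := Fin m) n
  rw [Fintype.card_fin] at this
  rw [← this, ← Nat.card_eq_fintype_card]
  rfl

lemma mem_approxGraph_vertexSet {n : ℕ} {x : X} :
    x ∈ V(approxGraph f V₀ n) ↔
      ∃ w : List (Fin m), w.length = n ∧ ∃ a ∈ V₀, wordMap f w a = x := by
  simp [approxGraph]

lemma approxGraph_vertexSet_zero : V(approxGraph f V₀ 0) = V₀ := by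
  ext x
  simp [mem_approxGraph_vertexSet, wordMap]

lemma approxGraph_vertexSet_succ (n : ℕ) :
    V(approxGraph f V₀ (n + 1)) = ⋃ i, f i '' V(approxGraph f V₀ n) := by
  ext x
  simp only [mem_approxGraph_vertexSet, mem_iUnion, mem_image]
  constructor
  · rintro ⟨_ | ⟨i, w⟩, hw, a, ha, rfl⟩
    · simp at hw
    · exact ⟨i, _, ⟨w, by simpa using hw, a, ha, rfl⟩, rfl⟩
  · rintro ⟨i, _, ⟨w, hw, a, ha, rfl⟩, rfl⟩
    exact ⟨i :: w, by simp [hw], a, ha, rfl⟩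

lemma approxGraph_edgeSet_eq (n : ℕ) : E(approxGraph f V₀ n) =
    {w : List (Fin m) | w.length = n} ×ˢ (Sym2.mk.uncurry '' V₀.offDiag) := by
  ext ⟨w, s⟩
  constructor
  · rintro ⟨x, y, hn, a, ha, b, hb, hab, hs, -⟩
    exact ⟨hn, (a, b), ⟨ha, hb, hab⟩, hs.symm⟩
  · rintro ⟨hn, ⟨a, b⟩, ⟨ha, hb, hab⟩, hs⟩
    exact ⟨_, _, hn, a, ha, b, hb, hab, hs.symm, rfl, rfl⟩

end approxGraph

/-! ### Finitely ramified self-similar sets -/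

namespace IsFinitelyRamified

variable {X : Type*} [MetricSpace X] {m : ℕ} {f : Fin m → X → X} {K V₀ : Set X}

lemma wordMap_injective (h : IsFinitelyRamified f K V₀) (w : List (Fin m)) :
    Function.Injective (wordMap f w) := by
  induction w with
  | nil => exact Function.injective_id
  | cons i w ih => exact (h.injective i).comp ih

lemma wordMap_continuous (h : IsFinitelyRamified f K V₀) (w : List (Fin m)) :
    Continuous (wordMap f w) := by
  induction w with
  | nil => exact continuous_id
  | cons i w ih =>
    obtain ⟨c, hc⟩ := h.contracting i
    exact hc.2.continuous.comp ih

lemma mapsTo (h : IsFinitelyRamified f K V₀) (i : Fin m) : MapsTo (f i) K K := by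
  intro x hx
  rw [h.self_similar]
  exact mem_iUnion.2 ⟨i, x, hx, rfl⟩

lemma wordMap_mapsTo (h : IsFinitelyRamified f K V₀) (w : List (Fin m)) :
    MapsTo (wordMap f w) K K := by
  induction w with
  | nil => exact mapsTo_id _
  | cons i w ih => exact (h.mapsTo i).comp ih

lemma exists_word (h : IsFinitelyRamified f K V₀) (n : ℕ) {x : X} (hx : x ∈ K) :
    ∃ w : List (Fin m), w.length = n ∧ x ∈ wordMap f w '' K := by
  induction n generalizing x with
  | zero => exact ⟨[], rfl, x, hx, rfl⟩
  | succ n ih =>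
    rw [h.self_similar] at hx
    obtain ⟨i, y, hy, rfl⟩ := mem_iUnion.1 hx
    obtain ⟨w, hw, z, hz, rfl⟩ := ih hy
    exact ⟨i :: w, by simp [hw], z, hz, rfl⟩

lemma fixed_unique (h : IsFinitelyRamified f K V₀) {i : Fin m} {x y : X} (hx : f i x = x)
    (hy : f i y = y) : x = y := by
  obtain ⟨c, hc⟩ := h.contracting i
  exact hc.fixedPoint_unique' hx hy

lemma boundary_finite (h : IsFinitelyRamified f K V₀) : V₀.Finite := by
  refine (finite_iUnion fun i : Fin m ↦ (?_ : {x | f i x = x}.Finite)).subset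
    fun x hx ↦ mem_iUnion.2 (h.boundary_fixed x hx)
  exact Subsingleton.finite fun x hx y hy ↦ h.fixed_unique hx hy

lemma boundary_subset (h : IsFinitelyRamified f K V₀) : V₀ ⊆ K := by
  intro x hx
  obtain ⟨i, hi⟩ := h.boundary_fixed x hx
  obtain ⟨c, hc⟩ := h.contracting i
  obtain ⟨z, hz⟩ := h.nonempty
  obtain ⟨y, hy, hfy, -⟩ := ContractingWith.exists_fixedPoint' h.isCompact.isComplete
    (h.mapsTo i) (hc.restrict (h.mapsTo i)) hz (edist_ne_top _ _)
  rwa [hc.fixedPoint_unique' hi hfy]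

lemma one_lt (h : IsFinitelyRamified f K V₀) (hV : 1 < V₀.ncard) : 1 < m := by
  by_contra! hm
  have : Subsingleton (Fin m) := ⟨fun i j ↦ Fin.ext (by omega)⟩
  obtain ⟨a, ha, b, hb, hab⟩ := (one_lt_ncard h.boundary_finite).1 hV
  obtain ⟨i, hi⟩ := h.boundary_fixed a ha
  obtain ⟨j, hj⟩ := h.boundary_fixed b hb
  exact hab (h.fixed_unique hi (Subsingleton.elim j i ▸ hj))

/-! ### Counting vertices -/

lemma finite_vertexSet (h : IsFinitelyRamified f K V₀) (n : ℕ) :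
    V(approxGraph f V₀ n).Finite :=
  (finite_words m n).biUnion fun _ _ ↦ h.boundary_finite.image _

lemma vertexSet_subset (h : IsFinitelyRamified f K V₀) (n : ℕ) :
    V(approxGraph f V₀ n) ⊆ K := by
  intro x hx
  obtain ⟨w, -, a, ha, rfl⟩ := mem_approxGraph_vertexSet.1 hx
  exact h.wordMap_mapsTo w (h.boundary_subset ha)

lemma boundary_subset_vertexSet (h : IsFinitelyRamified f K V₀) (n : ℕ) :
    V₀ ⊆ V(approxGraph f V₀ n) := by
  induction n with
  | zero => rw [approxGraph_vertexSet_zero]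
  | succ n ih =>
    intro x hx
    obtain ⟨i, hi⟩ := h.boundary_fixed x hx
    rw [approxGraph_vertexSet_succ]
    exact mem_iUnion.2 ⟨i, x, ih hx, hi⟩

/-- If `f i x = f j y`, then `x` is a boundary point as soon as `i ≠ j` (by finite ramification) or
`y` is a boundary point (by injectivity, if `i = j`). -/
lemma mem_boundary_of_eq (h : IsFinitelyRamified f K V₀) {i j : Fin m} {x y : X} (hx : x ∈ K)
    (hy : y ∈ K) (hxy : f i x = f j y) (hy' : y ∈ V₀ ∨ i ≠ j) :
    x ∈ V₀ := by
  by_cases hij : i = j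
  · subst hij
    rw [h.injective i hxy]
    exact hy'.resolve_right (by simp)
  · have h1 := h.inter_eq [i] [j] rfl (by simpa using hij)
    have h2 : f i x ∈ wordMap f [i] '' K ∩ wordMap f [j] '' K := ⟨⟨x, hx, rfl⟩, ⟨y, hy, hxy.symm⟩⟩
    rw [h1] at h2
    obtain ⟨⟨z, hz, hzx⟩, -⟩ := h2
    rwa [← h.injective i hzx]

/-- Outside `V₁`, the set `V (n + 1)` consists of `m` disjoint copies of `V n \ V₀`. -/
lemma ncard_vertexSet_succ (h : IsFinitelyRamified f K V₀) (n : ℕ) :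
    V(approxGraph f V₀ (n + 1)).ncard + m * V₀.ncard =
      V(approxGraph f V₀ 1).ncard + m * V(approxGraph f V₀ n).ncard := by
  set V := V(approxGraph f V₀ n) with hV
  have hV1 : V(approxGraph f V₀ 1) = ⋃ i, f i '' V₀ := by
    rw [approxGraph_vertexSet_succ, approxGraph_vertexSet_zero]
  have hsub : V(approxGraph f V₀ 1) ⊆ V(approxGraph f V₀ (n + 1)) := by
    rw [hV1, approxGraph_vertexSet_succ]
    exact iUnion_mono fun i ↦ image_mono (h.boundary_subset_vertexSet n)
  have h1 := ncard_sdiff_add_ncard_of_subset hsub (h.finite_vertexSet _)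
  have h2 := ncard_sdiff_add_ncard_of_subset (h.boundary_subset_vertexSet n)
    (h.finite_vertexSet _)
  have hVK := h.vertexSet_subset n
  rw [← hV] at h2 hVK
  have h3 : V(approxGraph f V₀ (n + 1)) \ V(approxGraph f V₀ 1) =
      (fun p : Fin m × X ↦ f p.1 p.2) '' (univ ×ˢ (V \ V₀)) := by
    ext x
    rw [hV1, approxGraph_vertexSet_succ]
    simp only [Set.mem_sdiff, mem_iUnion, mem_image, mem_prod, mem_univ, true_and, Prod.exists,
      not_exists, not_and]
    constructor
    · rintro ⟨⟨i, y, hy, rfl⟩, hn⟩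
      exact ⟨i, y, ⟨hy, fun hy0 ↦ hn i y hy0 rfl⟩, rfl⟩
    · rintro ⟨i, y, ⟨hy, hy0⟩, rfl⟩
      exact ⟨⟨i, y, hy, rfl⟩, fun j z hz hzy ↦ hy0 (h.mem_boundary_of_eq (hVK hy)
        (h.boundary_subset hz) hzy.symm (Or.inl hz))⟩
  have h4 : (V(approxGraph f V₀ (n + 1)) \ V(approxGraph f V₀ 1)).ncard = m * (V \ V₀).ncard := by
    rw [h3, InjOn.ncard_image, ncard_prod, ncard_univ, Nat.card_fin]
    rintro ⟨i, x⟩ ⟨-, hx, hx0⟩ ⟨j, y⟩ ⟨-, hy, -⟩ hxy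
    dsimp only at hx hx0 hy hxy
    by_cases hij : i = j
    · subst hij
      rw [h.injective i hxy]
    · exact absurd (h.mem_boundary_of_eq (hVK hx) (hVK hy) hxy (Or.inr hij)) hx0
  rw [← h1, h4, ← h2]
  ring

/-- If `V₁ = V₀`, a map `f i` would send two boundary points at minimal distance to two boundary
points at a smaller distance. -/
lemma ncard_boundary_lt (h : IsFinitelyRamified f K V₀) (hV : 1 < V₀.ncard) :
    V₀.ncard < V(approxGraph f V₀ 1).ncard := by
  refine ncard_lt_ncard ((h.boundary_subset_vertexSet 1).ssubset_of_ne fun heq ↦ ?_)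
    (h.finite_vertexSet 1)
  have hfin := h.boundary_finite
  obtain ⟨a₀, ha₀, b₀, hb₀, hab₀⟩ := (one_lt_ncard hfin).1 hV
  obtain ⟨i, -⟩ := h.boundary_fixed a₀ ha₀
  have hmaps : ∀ x ∈ V₀, f i x ∈ V₀ := by
    intro x hx
    rw [heq, approxGraph_vertexSet_succ, approxGraph_vertexSet_zero]
    exact mem_iUnion.2 ⟨i, x, hx, rfl⟩
  obtain ⟨⟨a, b⟩, ⟨ha, hb, hab⟩, hmin⟩ := Set.exists_min_image V₀.offDiag
    (fun p ↦ dist p.1 p.2) hfin.offDiag ⟨(a₀, b₀), ha₀, hb₀, hab₀⟩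
  obtain ⟨c, hc⟩ := h.contracting i
  have h1 := hmin (f i a, f i b) ⟨hmaps a ha, hmaps b hb, (h.injective i).ne hab⟩
  have h2 := hc.2.dist_le_mul a b
  have h3 : (c : ℝ) < 1 := by exact_mod_cast hc.1
  have h4 : 0 < dist a b := dist_pos.2 hab
  dsimp only at h1
  nlinarith

/-! ### Counting edges, triangles and connectedness -/

lemma finite_edgeSet (h : IsFinitelyRamified f K V₀) (n : ℕ) :
    E(approxGraph f V₀ n).Finite := by
  rw [approxGraph_edgeSet_eq]
  exact (finite_words m n).prod (h.boundary_finite.offDiag.image _)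

lemma ncard_edgeSet (h : IsFinitelyRamified f K V₀) (n : ℕ) :
    E(approxGraph f V₀ n).ncard = m ^ n * V₀.ncard.choose 2 := by
  classical
  rw [approxGraph_edgeSet_eq, ncard_prod, ncard_words]
  congr 1
  obtain ⟨s, rfl⟩ := h.boundary_finite.exists_finset_coe
  rw [ncard_coe_finset, ← Sym2.card_image_offDiag, ← ncard_coe_finset]
  simp

/-- If `|V₀| > 2`, then every edge lies in a triangle, namely one in its own cell. -/
lemma exists_triangle (h : IsFinitelyRamified f K V₀) (hV : 2 < V₀.ncard) (n : ℕ) {u v : X}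
    (huv : (approxGraph f V₀ n).Adj u v) : ∃ w, w ≠ u ∧ w ≠ v ∧
      (approxGraph f V₀ n).Adj u w ∧ (approxGraph f V₀ n).Adj v w := by
  obtain ⟨⟨w, s⟩, hn, a, ha, b, hb, hab, hs, rfl, rfl⟩ := huv
  obtain ⟨c, hc, hcab⟩ := exists_mem_notMem_of_ncard_lt_ncard
    (((ncard_insert_le a {b}).trans (by simp)).trans_lt hV) (toFinite {a, b})
  simp only [mem_insert_iff, mem_singleton_iff, not_or] at hcab
  have hinj := h.wordMap_injective w
  exact ⟨wordMap f w c, hinj.ne hcab.1, hinj.ne hcab.2,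
    ⟨(w, s(a, c)), hn, a, ha, c, hc, Ne.symm hcab.1, rfl, rfl, rfl⟩,
    ⟨(w, s(b, c)), hn, b, hb, c, hc, Ne.symm hcab.2, rfl, rfl, rfl⟩⟩

/-- The vertices of one cell are mutually adjacent. If there were several connected components, then
the cells whose vertices lie in one of them and the remaining cells would form two disjoint
closed sets covering the connected set `K`. -/
lemma isConn (h : IsFinitelyRamified f K V₀) (hK : IsConnected K) (hV : V₀.Nonempty) (n : ℕ) :
    (approxGraph f V₀ n).IsConn := by
  set G := approxGraph f V₀ n with hG
  obtain ⟨p, hp⟩ := hV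
  refine ⟨⟨p, h.boundary_subset_vertexSet n hp⟩, fun x hx y hy ↦ ?_⟩
  obtain ⟨wx, hwx, a, ha, rfl⟩ := mem_approxGraph_vertexSet.1 hx
  obtain ⟨wy, hwy, b, hb, rfl⟩ := mem_approxGraph_vertexSet.1 hy
  have hcell : ∀ {w : List (Fin m)} {a b}, w.length = n → a ∈ V₀ → b ∈ V₀ →
      Relation.ReflTransGen G.Adj (wordMap f w a) (wordMap f w b) := by
    intro w a b hw ha hb
    by_cases hab : a = b
    · rw [hab]
    · exact .single ⟨(w, s(a, b)), hw, a, ha, b, hb, hab, rfl, rfl, rfl⟩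
  let A : Set (List (Fin m)) :=
    {w | w.length = n ∧ Relation.ReflTransGen G.Adj (wordMap f wx a) (wordMap f w p)}
  let B : Set (List (Fin m)) :=
    {w | w.length = n ∧ ¬ Relation.ReflTransGen G.Adj (wordMap f wx a) (wordMap f w p)}
  have hclosed : ∀ S ⊆ {w : List (Fin m) | w.length = n}, IsClosed (⋃ w ∈ S, wordMap f w '' K) :=
    fun S hS ↦ ((finite_words m n).subset hS).isClosed_biUnion fun w _ ↦
      (h.isCompact.image (h.wordMap_continuous w)).isClosed
  have hmem : ∀ {S : Set (List (Fin m))} {w c}, w ∈ S → c ∈ V₀ →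
      (K ∩ ⋃ w ∈ S, wordMap f w '' K).Nonempty := fun {S w c} hw hc ↦
    ⟨wordMap f w c, h.wordMap_mapsTo w (h.boundary_subset hc),
      mem_biUnion hw ⟨c, h.boundary_subset hc, rfl⟩⟩
  by_contra hxy
  have hyB : wy ∈ B := ⟨hwy, fun hr ↦ hxy (hr.trans (hcell hwy hp hb))⟩
  obtain ⟨z, -, hzA, hzB⟩ := isPreconnected_closed_iff.1 hK.isPreconnected _ _
    (hclosed A fun w hw ↦ hw.1) (hclosed B fun w hw ↦ hw.1) (fun z hz ↦ by
      obtain ⟨w, hw, hzw⟩ := h.exists_word n hz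
      by_cases hr : Relation.ReflTransGen G.Adj (wordMap f wx a) (wordMap f w p)
      · exact Or.inl (mem_biUnion (x := w) ⟨hw, hr⟩ hzw)
      · exact Or.inr (mem_biUnion (x := w) ⟨hw, hr⟩ hzw))
    (hmem (w := wx) ⟨hwx, hcell hwx ha hp⟩ hp) (hmem hyB hp)
  obtain ⟨w, ⟨hw, hr⟩, hzw⟩ := mem_iUnion₂.1 hzA
  obtain ⟨w', ⟨hw', hr'⟩, hzw'⟩ := mem_iUnion₂.1 hzB
  have hne : w ≠ w' := by rintro rfl; exact hr' hr
  have hz : z ∈ wordMap f w '' K ∩ wordMap f w' '' K := ⟨hzw, hzw'⟩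
  rw [h.inter_eq w w' (hw.trans hw'.symm) hne] at hz
  obtain ⟨⟨c, hc, rfl⟩, d, hd, hdc⟩ := hz
  exact hr' ((hr.trans (hcell hw hp hc)).trans (hdc ▸ hcell hw' hd hp))

end IsFinitelyRamified

/-! ### Asymptotics -/

section Asymptotics

variable {v t : ℕ → ℝ} {a b A B : ℝ}

lemma tendsto_linear_div (hv : Tendsto v atTop atTop) :
    Tendsto (fun n ↦ (((a * v n + A) / v n : ℝ) : EReal)) atTop (𝓝 (a : EReal)) := by
  refine (continuous_coe_real_ereal.tendsto a).comp ?_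
  have h1 : Tendsto (fun n ↦ a + A * (v n)⁻¹) atTop (𝓝 (a + A * 0)) :=
    ((tendsto_inv_atTop_zero.comp hv).const_mul A).const_add a
  rw [mul_zero, add_zero] at h1
  refine h1.congr' ?_
  filter_upwards [hv.eventually_gt_atTop 0] with n hn
  field_simp

lemma le_liminf_div_of_linear_le (hv : Tendsto v atTop atTop) (h : ∀ n, a * v n + A ≤ t n) :
    (a : EReal) ≤ liminf (fun n ↦ ((t n / v n : ℝ) : EReal)) atTop := by
  rw [← (tendsto_linear_div (a := a) (A := A) hv).liminf_eq]
  refine liminf_le_liminf ?_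
  filter_upwards [hv.eventually_gt_atTop 0] with n hn
  exact EReal.coe_le_coe_iff.2 (div_le_div_of_nonneg_right (h n) hn.le)

lemma limsup_div_le_of_le_linear (hv : Tendsto v atTop atTop) (h : ∀ n, t n ≤ b * v n + B) :
    limsup (fun n ↦ ((t n / v n : ℝ) : EReal)) atTop ≤ (b : EReal) := by
  rw [← (tendsto_linear_div (a := b) (A := B) hv).limsup_eq]
  refine limsup_le_limsup ?_
  filter_upwards [hv.eventually_gt_atTop 0] with n hn
  exact EReal.coe_le_coe_iff.2 (div_le_div_of_nonneg_right (h n) hn.le)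

lemma isTheta_of_linear_le_of_le_linear (hv : Tendsto v atTop atTop) (ha : 0 < a)
    (h₁ : ∀ n, a * v n + A ≤ t n) (h₂ : ∀ n, t n ≤ b * v n + B) : t =Θ[atTop] v := by
  constructor
  · refine Asymptotics.IsBigO.of_bound (|b| + 1) ?_
    filter_upwards [hv.eventually_ge_atTop |B|, hv.eventually_ge_atTop (-A / a)] with n hn hn'
    have hv0 : 0 ≤ v n := (abs_nonneg _).trans hn
    rw [div_le_iff₀ ha] at hn'
    have ht0 : 0 ≤ t n := by linarith [h₁ n]
    rw [Real.norm_of_nonneg hv0, Real.norm_of_nonneg ht0]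
    nlinarith [h₂ n, le_abs_self b, le_abs_self B]
  · refine Asymptotics.IsBigO.of_bound (2 / a) ?_
    filter_upwards [hv.eventually_ge_atTop 0, hv.eventually_ge_atTop (-2 * A / a)] with n hv0 hn
    rw [div_le_iff₀ ha] at hn
    have h1 : a * v n ≤ 2 * t n := by linarith [h₁ n]
    have ht0 : 0 ≤ t n := by nlinarith
    rw [Real.norm_of_nonneg hv0, Real.norm_of_nonneg ht0, div_mul_eq_mul_div, le_div_iff₀ ha]
    linarith

end Asymptotics

namespace IsFinitelyRamified

variable {X : Type*} [MetricSpace X] {m : ℕ} {f : Fin m → X → X} {K V₀ : Set X}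

/-- If `G 1` is a tree, then its one spanning tree is too few for `|V₀| > 2`. So `G 0` is a tree,
too, and the recursions for the numbers of vertices and edges give `|E n| + 1 = |V n|`. -/
lemma isTree_approxGraph (h : IsFinitelyRamified f K V₀) (hK : IsConnected K)
    (ht : (approxGraph f V₀ 1).IsTree) (n : ℕ) : (approxGraph f V₀ n).IsTree := by
  obtain ⟨x, hx⟩ := ht.1.1
  obtain ⟨-, -, p, hp, -⟩ := mem_approxGraph_vertexSet.1 hx
  have hV₀ : V₀.Nonempty := ⟨p, hp⟩
  have hpos : 0 < V₀.ncard := (ncard_pos h.boundary_finite).2 hV₀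
  have hle : V₀.ncard ≤ 2 := by
    by_contra! h2
    have h3 := Graph.three_pow_le_numSpanningTrees ht.1 (h.finite_vertexSet 1) (h.finite_edgeSet 1)
      fun u v _ huv ↦ h.exists_triangle h2 1 huv
    rw [ht.numSpanningTrees_eq_one (h.finite_vertexSet 1) (h.finite_edgeSet 1)] at h3
    have h4 := h2.trans_le (ncard_le_ncard (h.boundary_subset_vertexSet 1) (h.finite_vertexSet 1))
    have h5 := Nat.pow_le_pow_right (n := 3) (by norm_num) h4
    norm_num at h3 h5
    omega
  -- `G 0` satisfies `|E| + 1 = |V|`.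
  have hchoose : V₀.ncard.choose 2 + 1 = V₀.ncard := by
    interval_cases V₀.ncard <;> rfl
  have h1 := (Graph.isTree_iff ht.1 (h.finite_vertexSet 1) (h.finite_edgeSet 1)).1 ht
  rw [Graph.isTree_iff (h.isConn hK hV₀ n) (h.finite_vertexSet n) (h.finite_edgeSet n)]
  rw [h.ncard_edgeSet] at h1 ⊢
  generalize V₀.ncard.choose 2 = C at h1 hchoose ⊢
  induction n with
  | zero => rw [approxGraph_vertexSet_zero, pow_zero, one_mul, hchoose]
  | succ n ih =>
    have h2 := h.ncard_vertexSet_succ n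
    rw [← h1, ← ih, ← hchoose] at h2
    rw [pow_succ]
    nlinarith

/-- The solution of the recursion `ncard_vertexSet_succ`. -/
lemma cast_ncard_vertexSet (h : IsFinitelyRamified f K V₀) (hm : 1 < m) (n : ℕ) :
    (V(approxGraph f V₀ n).ncard : ℝ) = V₀.ncard +
      ((V(approxGraph f V₀ 1).ncard : ℝ) - V₀.ncard) / (m - 1) * ((m : ℝ) ^ n - 1) := by
  have hm' : (m : ℝ) - 1 ≠ 0 := sub_ne_zero.2 (by exact_mod_cast hm.ne')
  induction n with
  | zero => simp [approxGraph_vertexSet_zero]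
  | succ n ih =>
    have h2 : (V(approxGraph f V₀ (n + 1)).ncard : ℝ) + m * V₀.ncard =
      V(approxGraph f V₀ 1).ncard + m * V(approxGraph f V₀ n).ncard := by
      exact_mod_cast h.ncard_vertexSet_succ n
    rw [eq_sub_of_add_eq h2, ih]
    field_simp
    ring

lemma two_mul_cast_ncard_edgeSet (h : IsFinitelyRamified f K V₀) (n : ℕ) :
    2 * (E(approxGraph f V₀ n).ncard : ℝ) =
      (m : ℝ) ^ n * ((V₀.ncard : ℝ) * ((V₀.ncard : ℝ) - 1)) := by
  rw [h.ncard_edgeSet, Nat.cast_mul, Nat.cast_choose_two]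
  push_cast
  ring

end IsFinitelyRamified

theorem theorem4p1 {X : Type*} [MetricSpace X] [CompleteSpace X] {m : ℕ}
    (f : Fin m → X → X) (K V₀ : Set X) (hram : IsFinitelyRamified f K V₀)
    (hconn : IsConnected K) :
    ((approxGraph f V₀ 1).IsTree → ∀ n, (approxGraph f V₀ n).numSpanningTrees = 1) ∧
    (¬ (approxGraph f V₀ 1).IsTree → 2 < V₀.ncard →
      (fun n ↦ Real.log ((approxGraph f V₀ n).numSpanningTrees : ℝ)) =Θ[atTop]
        (fun n ↦ ((approxGraph f V₀ n).vertexSet.ncard : ℝ)) ∧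
      (fun n ↦ Real.log ((approxGraph f V₀ n).numSpanningTrees : ℝ)) =Θ[atTop]
        (fun n ↦ (m : ℝ) ^ n) ∧
      (fun n ↦ ((approxGraph f V₀ n).vertexSet.ncard : ℝ)) =Θ[atTop]
        (fun n ↦ (m : ℝ) ^ n) ∧
      ((Real.log 3 / 2 : ℝ) : EReal) ≤
        liminf (fun n ↦ ((Real.log ((approxGraph f V₀ n).numSpanningTrees : ℝ) /
          ((approxGraph f V₀ n).vertexSet.ncard : ℝ) : ℝ) : EReal)) atTop ∧
      liminf (fun n ↦ ((Real.log ((approxGraph f V₀ n).numSpanningTrees : ℝ) /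
          ((approxGraph f V₀ n).vertexSet.ncard : ℝ) : ℝ) : EReal)) atTop ≤
        limsup (fun n ↦ ((Real.log ((approxGraph f V₀ n).numSpanningTrees : ℝ) /
          ((approxGraph f V₀ n).vertexSet.ncard : ℝ) : ℝ) : EReal)) atTop ∧
      limsup (fun n ↦ ((Real.log ((approxGraph f V₀ n).numSpanningTrees : ℝ) /
          ((approxGraph f V₀ n).vertexSet.ncard : ℝ) : ℝ) : EReal)) atTop ≤
        ((Real.log (((m : ℝ) - 1) * (V₀.ncard : ℝ) * ((V₀.ncard : ℝ) - 1) /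
          (((approxGraph f V₀ 1).vertexSet.ncard : ℝ) - (V₀.ncard : ℝ))) : ℝ) : EReal)) := by
  refine ⟨fun ht n ↦ (hram.isTree_approxGraph hconn ht n).numSpanningTrees_eq_one
    (hram.finite_vertexSet n) (hram.finite_edgeSet n), fun _ hk ↦ ?_⟩
  obtain ⟨p, hp⟩ : V₀.Nonempty := nonempty_of_ncard_ne_zero (by omega)
  have : Nonempty (List (Fin m) × Sym2 X) := ⟨([], s(p, p))⟩
  have hm : 1 < m := hram.one_lt (by omega)
  have hm' : (1 : ℝ) < m := by exact_mod_cast hm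
  have hV := hram.finite_vertexSet
  have hE := hram.finite_edgeSet
  have hk' : (2 : ℝ) < V₀.ncard := by exact_mod_cast hk
  have hlt : (V₀.ncard : ℝ) < V(approxGraph f V₀ 1).ncard := by
    exact_mod_cast hram.ncard_boundary_lt (by omega)
  set k : ℝ := (V₀.ncard : ℝ)
  set d : ℝ := ((V(approxGraph f V₀ 1).ncard : ℝ) - k) / (m - 1) with hd
  have hd0 : 0 < d := div_pos (by linarith) (by linarith)
  set v : ℕ → ℝ := fun n ↦ V(approxGraph f V₀ n).ncard with hv
  set t : ℕ → ℝ := fun n ↦ Real.log (approxGraph f V₀ n).numSpanningTrees with ht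
  have hvn : ∀ n, v n = k + d * ((m : ℝ) ^ n - 1) := hram.cast_ncard_vertexSet hm
  have hpow : Tendsto (fun n ↦ (m : ℝ) ^ n) atTop atTop := tendsto_pow_atTop_atTop_of_one_lt hm'
  have hvt : Tendsto v atTop atTop := by
    refine Tendsto.congr (fun n ↦ (hvn n).symm) (tendsto_atTop_add_const_left _ _ ?_)
    exact (tendsto_atTop_add_const_right _ (-1) hpow).const_mul_atTop hd0
  have hvm : v =Θ[atTop] fun n ↦ (m : ℝ) ^ n := by
    refine isTheta_of_linear_le_of_le_linear (a := d) (A := k - d) (b := d) (B := k - d) hpow hd0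
      (fun n ↦ ?_) fun n ↦ ?_ <;> exact le_of_eq (by rw [hvn]; ring)
  have hpos : ∀ n, 3 ^ V(approxGraph f V₀ n).ncard ≤
      3 * (approxGraph f V₀ n).numSpanningTrees ^ 2 := fun n ↦
    Graph.three_pow_le_numSpanningTrees (hram.isConn hconn ⟨p, hp⟩ n) (hV n) (hE n)
      fun u v _ huv ↦ hram.exists_triangle hk n huv
  have hτ : ∀ n, 0 < (approxGraph f V₀ n).numSpanningTrees := fun n ↦
    Nat.pos_of_ne_zero fun h0 ↦ by
      have := hpos n
      rw [h0] at this
      simp at this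
  have hlow : ∀ n, Real.log 3 / 2 * v n + -(Real.log 3 / 2) ≤ t n := by
    intro n
    have h1 : (3 : ℝ) ^ V(approxGraph f V₀ n).ncard ≤
      3 * ((approxGraph f V₀ n).numSpanningTrees : ℝ) ^ 2 := by exact_mod_cast hpos n
    have h2 := Real.log_le_log (by positivity) h1
    have h3 : ((approxGraph f V₀ n).numSpanningTrees : ℝ) ^ 2 ≠ 0 := by
      have := hτ n
      positivity
    rw [Real.log_mul (by norm_num) h3, Real.log_pow, Real.log_pow] at h2
    simp only [hv, ht]
    push_cast at h2
    linarith
  -- `c` is the limit of the average degree of `G n`.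
  set c : ℝ := ((m : ℝ) - 1) * k * (k - 1) / ((V(approxGraph f V₀ 1).ncard : ℝ) - k) with hc
  have hc0 : 0 < c :=
    div_pos (mul_pos (mul_pos (by linarith) (by linarith)) (by linarith)) (by linarith)
  have hcd : c * d = k * (k - 1) := by
    have h1 : (m : ℝ) - 1 ≠ 0 := by linarith
    have h2 : (V(approxGraph f V₀ 1).ncard : ℝ) - k ≠ 0 := by linarith
    rw [hc, hd]
    field_simp
  have hup : ∀ n, t n ≤ Real.log c * v n + (d - k + 1 - Real.log c) := by
    intro n
    have h1 := Graph.log_numSpanningTrees_le (hV n) (hE n)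
      (hram.boundary_subset_vertexSet n hp) (hτ n) hc0
    rw [hram.two_mul_cast_ncard_edgeSet, ← hcd, mul_div_assoc, mul_div_cancel_left₀ _ hc0.ne'] at h1
    have h2 := hvn n
    simp only [hv, ht] at h2 ⊢
    linarith
  have hlog : 0 < Real.log 3 / 2 := by
    have := Real.log_pos (x := 3) (by norm_num)
    linarith
  have htv := isTheta_of_linear_le_of_le_linear hvt hlog hlow hup
  exact ⟨htv, htv.trans hvm, hvm, le_liminf_div_of_linear_le hvt hlow, liminf_le_limsup,
    limsup_div_le_of_le_linear hvt hup⟩
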